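/- Let $M$ be a smooth manifold of odd dimension $n=2m+1$ with a sub-Riemannian structure of contact type $(M,\vec\xi,\eta,g,D)$: $g$ is a smooth Riemannian metric, $\vec\xi$ a smooth vector field with $g(\vec\xi,\vec\xi)=1$, $\eta$ a smooth $1$-form with $\eta(\vec\xi)=1$, $D=\ker\eta$ and $D^\perp=\mathrm{Span}(\vec\xi)$ (no condition on the rank of $d\eta$ is imposed). Let $\omega=d\eta$ with the normalization $d\eta(X,Y)=\tfrac12\big(X\eta(Y)-Y\eta(X)-\eta([X,Y])\big)$, let the endomorphism $\psi$ of $TM$ be determined by $\omega(X,Y)=g(\psi X,Y)$, and let $C=\tfrac12L_{\vec\xi}\,g$. Let $(x^1,\dots,x^n)$ be an adapted chart, i.e. a smooth chart on whose domain $D^\perp=\mathrm{Span}(\partial_n)$ and $\partial_n=\vec\xi$. Let $P:TM\to D$ be the projector defined by $TM=D\oplus D^\perp$. For $a=1,\dots,n-1$ put $\vec e_a=P(\partial_a)$ and $\Gamma^n_a=\eta(\partial_a)$. Then, on the domain of the chart, $\vec e_a=\partial_a-\Gamma^n_a\partial_n$ and $(\vec e_1,\dots,\vec e_{n-1},\partial_n)$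 is a smooth frame. Put $\vec e_n=\partial_n$; let $a,b,c,d$ range over $1,\dots,n-1$, with summation over repeated indices; let $g_{ab}=g(\vec e_a,\vec e_b)$ with inverse matrix $(g^{ab})$, $\omega_{ab}=\omega(\vec e_a,\vec e_b)$, $C_{ab}=C(\vec e_a,\vec e_b)$, $C^b_a=g^{bc}C_{ac}$, and let $\psi^b_a$ be the $\vec e_b$-component of $\psi\vec e_a$ in this frame. Let $\tilde\nabla$ be the Levi-Civita connection of $g$, and let $\tilde\Gamma^k_{ij}$ be its Christoffel symbols in this frame, $\tilde\nabla_{\vec e_i}\vec e_j=\sum_{k=1}^n\tilde\Gamma^k_{ij}\,\vec e_k$. Then on the domain of the chart $$\tilde\Gamma^c_{ab}=\Gamma^c_{ab},\quad \tilde\Gamma^n_{ab}=\omega_{ba}-C_{ab},\quad \tilde\Gamma^b_{an}=\tilde\Gamma^b_{na}=C^b_a+\psi^b_a,\quad \tilde\Gamma^n_{na}=-\partial_n\Gamma^n_a,\quad \tilde\Gamma^a_{nn}=g^{ab}\,\partial_n\Gamma^n_b,$$ and the remaining symbols vanish: $\tilde\Gamma^n_{an}=0$ and $\tilde\Gamma^n_{nn}=0$.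 Here $$\Gamma^a_{bc}=\tfrac12 g^{ad}\big(\vec e_b g_{cd}+\vec e_c g_{bd}-\vec e_d g_{bc}\big),$$ and moreover $\psi^b_a=g^{bc}\omega_{ac}$ and $C_{ab}=\tfrac12\,\partial_n g_{ab}$. -/

import Mathlib

open Bundle VectorField
open scoped Manifold ContDiff Bundle

noncomputable section

namespace SubRiem

/-- Vector fields (not necessarily smooth) on a manifold of dimension `2 m + 1`. -/
abbrev VField (m : ℕ) (M : Type*) [TopologicalSpace M]
    [ChartedSpace (EuclideanSpace ℝ (Fin (2 * m + 1))) M] :=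
  ∀ x : M, TangentSpace (𝓡 (2 * m + 1)) x

section

variable (m : ℕ) (M : Type*) [TopologicalSpace M]
  [ChartedSpace (EuclideanSpace ℝ (Fin (2 * m + 1))) M] [IsManifold (𝓡 (2 * m + 1)) ∞ M]
  [RiemannianBundle (fun x : M ↦ TangentSpace (𝓡 (2 * m + 1)) x)]

/-- A sub-Riemannian structure of contact type `(M, ξ, η, g, D)` on a manifold `M` of dimension
`2 m + 1`; the metric `g` is the ambient Riemannian metric on `M`. The `1`-form `η` and the unit
vector field `ξ` generate mutually orthogonal distributions `D = ker η` and `Dᗮ = Span ξ`, and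
`η` is normalised by `η(ξ) = 1`. No condition on the rank of `dη` is imposed. -/
structure ContactTypeStructure where
  ξ : VField m M
  η : ∀ x : M, TangentSpace (𝓡 (2 * m + 1)) x →L[ℝ] ℝ
  D : ∀ x : M, Submodule ℝ (TangentSpace (𝓡 (2 * m + 1)) x)
  contMDiff_ξ : ContMDiff (𝓡 (2 * m + 1)) (𝓡 (2 * m + 1)).tangent ∞
    (fun x ↦ (⟨x, ξ x⟩ : TangentBundle (𝓡 (2 * m + 1)) M))
  contMDiff_η : ContMDiff (𝓡 (2 * m + 1))
    ((𝓡 (2 * m + 1)).prod 𝓘(ℝ, EuclideanSpace ℝ (Fin (2 * m + 1)) →L[ℝ] ℝ)) ∞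
    (fun x ↦ TotalSpace.mk' (EuclideanSpace ℝ (Fin (2 * m + 1)) →L[ℝ] ℝ)
      (E := fun x ↦ TangentSpace (𝓡 (2 * m + 1)) x →L[ℝ] Bundle.Trivial M ℝ x) x (η x))
  inner_ξ_ξ : ∀ x, inner ℝ (ξ x) (ξ x) = 1
  η_ξ : ∀ x, η x (ξ x) = 1
  D_eq : ∀ x, D x = (η x).ker
  orthogonal_D_eq : ∀ x, (D x)ᗮ = Submodule.span ℝ {ξ x}

end

section

variable {m : ℕ} {M : Type*} [TopologicalSpace M]
  [ChartedSpace (EuclideanSpace ℝ (Fin (2 * m + 1))) M] [IsManifold (𝓡 (2 * m + 1)) ∞ M]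

/-- Differentiability of a vector field at a point. -/
abbrev DiffAt (X : VField m M) (x : M) : Prop :=
  MDifferentiableAt (𝓡 (2 * m + 1)) (𝓡 (2 * m + 1)).tangent
    (fun y ↦ (⟨y, X y⟩ : TangentBundle (𝓡 (2 * m + 1)) M)) x

/-- The derivative `(X f)(x)` of a function `f` along a vector field `X`. -/
def dirDeriv (X : VField m M) (f : M → ℝ) (x : M) : ℝ :=
  mvfderiv (𝓡 (2 * m + 1)) f x (X x)

/-- The coordinate vector field `∂ᵢ` of the chart `φ`, that is, the pullback under `φ` of the
constant `i`-th standard basis vector field. Only its values on `φ.source` are meaningful. -/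
def coordField (φ : OpenPartialHomeomorph M (EuclideanSpace ℝ (Fin (2 * m + 1))))
    (i : Fin (2 * m + 1)) : VField m M :=
  mpullback (𝓡 (2 * m + 1)) 𝓘(ℝ, EuclideanSpace ℝ (Fin (2 * m + 1))) φ
    (fun _ ↦ EuclideanSpace.single i (1 : ℝ))

end

section

variable {m : ℕ} {M : Type*} [TopologicalSpace M]
  [ChartedSpace (EuclideanSpace ℝ (Fin (2 * m + 1))) M] [IsManifold (𝓡 (2 * m + 1)) ∞ M]
  [RiemannianBundle (fun x : M ↦ TangentSpace (𝓡 (2 * m + 1)) x)]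

instance finiteDimensional_tangentSpace (x : M) :
    FiniteDimensional ℝ (TangentSpace (𝓡 (2 * m + 1)) x) :=
  inferInstanceAs (FiniteDimensional ℝ (EuclideanSpace ℝ (Fin (2 * m + 1))))

instance completeSpace_tangentSpace (x : M) :
    CompleteSpace (TangentSpace (𝓡 (2 * m + 1)) x) :=
  FiniteDimensional.complete ℝ _

namespace ContactTypeStructure

variable (S : ContactTypeStructure m M)

theorem mdifferentiableAt_η {X : VField m M} {x : M} (hX : DiffAt X x) :
    MDifferentiableAt (𝓡 (2 * m + 1)) 𝓘(ℝ, ℝ) (fun y ↦ S.η y (X y)) x := by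
  have h : MDifferentiableAt (𝓡 (2 * m + 1)) ((𝓡 (2 * m + 1)).prod 𝓘(ℝ, ℝ))
      (fun y ↦ TotalSpace.mk' ℝ (E := Bundle.Trivial M ℝ) y (S.η y (X y))) x :=
    MDifferentiableAt.clm_bundle_apply (F₁ := EuclideanSpace ℝ (Fin (2 * m + 1)))
      (S.contMDiff_η.mdifferentiableAt (by simp)) hX
  rw [mdifferentiableAt_totalSpace] at h
  exact h.2

/-- `½ (X η(Y) - Y η(X) - η([X, Y]))` as an operation on vector fields. -/
def omegaAux (X Y : VField m M) (x : M) : ℝ :=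
  (1 / 2) * (dirDeriv X (fun y ↦ S.η y (Y y)) x - dirDeriv Y (fun y ↦ S.η y (X y)) x
    - S.η x (mlieBracket (𝓡 (2 * m + 1)) X Y x))

theorem tensorial_omegaAux₁ (x : M) (Y : VField m M) :
    TensorialAt (𝓡 (2 * m + 1)) (EuclideanSpace ℝ (Fin (2 * m + 1)))
      (fun X ↦ S.omegaAux X Y x) x where
  smul {f X} hf hX := by
    have h := mvfderiv_fun_mul hf (S.mdifferentiableAt_η hX)
    simp [omegaAux, dirDeriv, mlieBracket_smul_left hf hX, h]
    ring
  add {X X'} hX hX' := by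
    have h := mvfderiv_fun_add (S.mdifferentiableAt_η hX) (S.mdifferentiableAt_η hX')
    simp [omegaAux, dirDeriv, mlieBracket_add_left hX hX', h]
    ring

theorem tensorial_omegaAux₂ (x : M) (X : VField m M) :
    TensorialAt (𝓡 (2 * m + 1)) (EuclideanSpace ℝ (Fin (2 * m + 1)))
      (fun Y ↦ S.omegaAux X Y x) x where
  smul {f Y} hf hY := by
    have h := mvfderiv_fun_mul hf (S.mdifferentiableAt_η hY)
    simp [omegaAux, dirDeriv, mlieBracket_smul_right hf hY, h]
    ring
  add {Y Y'} hY hY' := by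
    have h := mvfderiv_fun_add (S.mdifferentiableAt_η hY) (S.mdifferentiableAt_η hY')
    simp [omegaAux, dirDeriv, mlieBracket_add_right hY hY', h]
    ring

/-- The `2`-form `ω = dη`, normalised as
`dη(X, Y) = ½ (X η(Y) - Y η(X) - η([X, Y]))`. -/
def omega (x : M) :
    TangentSpace (𝓡 (2 * m + 1)) x →L[ℝ] TangentSpace (𝓡 (2 * m + 1)) x →L[ℝ] ℝ :=
  TensorialAt.mkHom₂ (I := 𝓡 (2 * m + 1)) (F := EuclideanSpace ℝ (Fin (2 * m + 1)))
    (F' := EuclideanSpace ℝ (Fin (2 * m + 1))) (fun X Y ↦ S.omegaAux X Y x) x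
    (fun Y _ ↦ S.tensorial_omegaAux₁ x Y) (fun X _ ↦ S.tensorial_omegaAux₂ x X)

theorem omega_apply {X Y : VField m M} {x : M} (hX : DiffAt X x) (hY : DiffAt Y x) :
    S.omega x (X x) (Y x) =
      (1 / 2) * (dirDeriv X (fun y ↦ S.η y (Y y)) x - dirDeriv Y (fun y ↦ S.η y (X y)) x
        - S.η x (mlieBracket (𝓡 (2 * m + 1)) X Y x)) :=
  TensorialAt.mkHom₂_apply _ _ hX hY

/-- The endomorphism `ψ` of the tangent bundle with `ω(X, Y) = g(ψ X, Y)`. -/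
def psi (x : M) : TangentSpace (𝓡 (2 * m + 1)) x →L[ℝ] TangentSpace (𝓡 (2 * m + 1)) x :=
  InnerProductSpace.continuousLinearMapOfBilin (𝕜 := ℝ) (S.omega x)

theorem omega_eq_inner_psi (x : M) (v w : TangentSpace (𝓡 (2 * m + 1)) x) :
    S.omega x v w = inner ℝ (S.psi x v) w :=
  (InnerProductSpace.continuousLinearMapOfBilin_apply (𝕜 := ℝ) (S.omega x) v w).symm

/-- The projector onto `D` defined by the orthogonal decomposition `TM = D ⊕ Dᗮ`. -/
def P (x : M) : TangentSpace (𝓡 (2 * m + 1)) x →L[ℝ] TangentSpace (𝓡 (2 * m + 1)) x :=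
  (S.D x).starProjection

/-- `φ` is a chart of `M` adapted to `D`: on its domain `Dᗮ = Span(∂ₙ)` and `∂ₙ = ξ`. -/
structure IsAdaptedChart
    (φ : OpenPartialHomeomorph M (EuclideanSpace ℝ (Fin (2 * m + 1)))) : Prop where
  mem_maximalAtlas : φ ∈ IsManifold.maximalAtlas (𝓡 (2 * m + 1)) ∞ M
  orthogonal_D_eq : ∀ x ∈ φ.source,
    (S.D x)ᗮ = Submodule.span ℝ {coordField φ (Fin.last (2 * m)) x}
  coordField_last : ∀ x ∈ φ.source, coordField φ (Fin.last (2 * m)) x = S.ξ x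

variable (φ : OpenPartialHomeomorph M (EuclideanSpace ℝ (Fin (2 * m + 1))))

/-- The fields `eₐ = P(∂ₐ)`, `a = 1, …, n - 1`. -/
def e (a : Fin (2 * m)) : VField m M := fun x ↦ S.P x (coordField φ a.castSucc x)

/-- The functions `Γⁿₐ`, for which `eₐ = ∂ₐ - Γⁿₐ ∂ₙ`. -/
def GammaN (a : Fin (2 * m)) : M → ℝ := fun x ↦ S.η x (coordField φ a.castSucc x)

/-- The adapted frame `(e₁, …, eₙ₋₁, ∂ₙ)`. -/
def frame (i : Fin (2 * m + 1)) : VField m M :=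
  Fin.lastCases (motive := fun _ ↦ VField m M) (coordField φ (Fin.last (2 * m)))
    (fun a ↦ S.e φ a) i

/-- The matrix `g_{ab} = g(eₐ, e_b)`. -/
def gLow (x : M) : Matrix (Fin (2 * m)) (Fin (2 * m)) ℝ :=
  Matrix.of fun a b ↦ inner ℝ (S.e φ a x) (S.e φ b x)

/-- The matrix `g^{ab}`, inverse to `g_{ab}`. -/
def gUp (x : M) : Matrix (Fin (2 * m)) (Fin (2 * m)) ℝ := (S.gLow φ x)⁻¹

/-- `Γᵃ_{bc} = ½ g^{ad} (e_b g_{cd} + e_c g_{bd} - e_d g_{bc})`; the upper index comes first. -/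
def Gamma (a b c : Fin (2 * m)) (x : M) : ℝ :=
  (1 / 2) * ∑ d, S.gUp φ x a d *
    (dirDeriv (S.e φ b) (fun y ↦ S.gLow φ y c d) x
      + dirDeriv (S.e φ c) (fun y ↦ S.gLow φ y b d) x
      - dirDeriv (S.e φ d) (fun y ↦ S.gLow φ y b c) x)

/-- The components `ω_{ab} = ω(eₐ, e_b)`. -/
def omegaLow (a b : Fin (2 * m)) (x : M) : ℝ := S.omega x (S.e φ a x) (S.e φ b x)

end ContactTypeStructure

section Metric

variable [IsContMDiffRiemannianBundle (𝓡 (2 * m + 1)) ∞ (EuclideanSpace ℝ (Fin (2 * m + 1)))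
  (fun x : M ↦ TangentSpace (𝓡 (2 * m + 1)) x)]

instance isContMDiffRiemannianBundle_one :
    IsContMDiffRiemannianBundle (𝓡 (2 * m + 1)) 1 (EuclideanSpace ℝ (Fin (2 * m + 1)))
      (fun x : M ↦ TangentSpace (𝓡 (2 * m + 1)) x) :=
  IsContMDiffRiemannianBundle.of_le (n := ∞) (by simp)

/-- The Levi-Civita connection of `g`: metric and torsion-free. Here `cov Y x (X x)` is
`(∇_X Y)(x)`. -/
structure IsLeviCivita (cov : CovariantDerivative (𝓡 (2 * m + 1))
    (EuclideanSpace ℝ (Fin (2 * m + 1))) (TangentSpace (𝓡 (2 * m + 1)) : M → Type _)) :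
    Prop where
  metric : cov.IsMetricCompatible
  torsion_eq_zero : cov.torsion = 0

namespace ContactTypeStructure

variable (S : ContactTypeStructure m M)

/-- `½ (ξ g(X, Y) - g([ξ, X], Y) - g(X, [ξ, Y]))` as an operation on vector fields. -/
def CAux (X Y : VField m M) (x : M) : ℝ :=
  (1 / 2) * (dirDeriv S.ξ (fun y ↦ inner ℝ (X y) (Y y)) x
    - inner ℝ (mlieBracket (𝓡 (2 * m + 1)) S.ξ X x) (Y x)
    - inner ℝ (X x) (mlieBracket (𝓡 (2 * m + 1)) S.ξ Y x))

theorem tensorial_CAux₁ (x : M) (Y : VField m M) (hY : DiffAt Y x) :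
    TensorialAt (𝓡 (2 * m + 1)) (EuclideanSpace ℝ (Fin (2 * m + 1)))
      (fun X ↦ S.CAux X Y x) x where
  smul {f X} hf hX := by
    have h := mvfderiv_fun_mul hf (hX.inner_bundle hY)
    simp [CAux, dirDeriv, mlieBracket_smul_right hf hX, h, inner_add_left, inner_smul_left]
    ring
  add {X X'} hX hX' := by
    have h := mvfderiv_fun_add (hX.inner_bundle hY) (hX'.inner_bundle hY)
    simp [CAux, dirDeriv, mlieBracket_add_right hX hX', h, inner_add_left]
    ring

theorem tensorial_CAux₂ (x : M) (X : VField m M) (hX : DiffAt X x) :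
    TensorialAt (𝓡 (2 * m + 1)) (EuclideanSpace ℝ (Fin (2 * m + 1)))
      (fun Y ↦ S.CAux X Y x) x where
  smul {f Y} hf hY := by
    have h := mvfderiv_fun_mul hf (hX.inner_bundle hY)
    simp [CAux, dirDeriv, mlieBracket_smul_right hf hY, h, inner_add_right, inner_smul_right]
    ring
  add {Y Y'} hY hY' := by
    have h := mvfderiv_fun_add (hX.inner_bundle hY) (hX.inner_bundle hY')
    simp [CAux, dirDeriv, mlieBracket_add_right hY hY', h, inner_add_right]
    ring

/-- The tensor `C = ½ L_ξ g`, where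
`(L_ξ g)(X, Y) = ξ g(X, Y) - g([ξ, X], Y) - g(X, [ξ, Y])`. -/
def C (x : M) :
    TangentSpace (𝓡 (2 * m + 1)) x →L[ℝ] TangentSpace (𝓡 (2 * m + 1)) x →L[ℝ] ℝ :=
  TensorialAt.mkHom₂ (I := 𝓡 (2 * m + 1)) (F := EuclideanSpace ℝ (Fin (2 * m + 1)))
    (F' := EuclideanSpace ℝ (Fin (2 * m + 1))) (fun X Y ↦ S.CAux X Y x) x
    (S.tensorial_CAux₁ x) (S.tensorial_CAux₂ x)

theorem C_apply {X Y : VField m M} {x : M} (hX : DiffAt X x) (hY : DiffAt Y x) :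
    S.C x (X x) (Y x) = (1 / 2) * (dirDeriv S.ξ (fun y ↦ inner ℝ (X y) (Y y)) x
      - inner ℝ (mlieBracket (𝓡 (2 * m + 1)) S.ξ X x) (Y x)
      - inner ℝ (X x) (mlieBracket (𝓡 (2 * m + 1)) S.ξ Y x)) :=
  TensorialAt.mkHom₂_apply _ _ hX hY

variable (φ : OpenPartialHomeomorph M (EuclideanSpace ℝ (Fin (2 * m + 1))))

/-- The components `C_{ab} = C(eₐ, e_b)`. -/
def CLow (a b : Fin (2 * m)) (x : M) : ℝ := S.C x (S.e φ a x) (S.e φ b x)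

/-- `C^b_a = g^{bc} C_{ac}`; the upper index comes first. -/
def CMixed (b a : Fin (2 * m)) (x : M) : ℝ := ∑ c, S.gUp φ x b c * S.CLow φ a c x

/-- The Christoffel symbol `Γ̃ᵏ_{ij}` of a connection in the adapted frame `E = (eₐ, ∂ₙ)`:
the `k`-th coefficient of `∇_{E_i} E_j` (the upper index comes first). -/
def christoffel {φ : OpenPartialHomeomorph M (EuclideanSpace ℝ (Fin (2 * m + 1)))}
    (h : IsLocalFrameOn (𝓡 (2 * m + 1)) (EuclideanSpace ℝ (Fin (2 * m + 1))) ∞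
      (S.frame φ) φ.source)
    (cov : CovariantDerivative (𝓡 (2 * m + 1))
      (EuclideanSpace ℝ (Fin (2 * m + 1))) (TangentSpace (𝓡 (2 * m + 1)) : M → Type _))
    (k i j : Fin (2 * m + 1)) (x : M) : ℝ :=
  h.coeff k x (cov (S.frame φ j) x (S.frame φ i x))

end ContactTypeStructure

end Metric

end

end SubRiem

end

/-! The adapted frame has two features that make the Koszul formula short. The metric is block
diagonal in it: every `e a` is orthogonal to ∂ₙ and ∂ₙ = ξ is a unit field, so ∂ₙ-components are
inner products with ∂ₙ and the others come from inverting the Gram matrix `gLow`. And all its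
brackets are vertical: coordinate fields commute, so expanding eₐ = ∂ₐ - Γⁿₐ ∂ₙ leaves only
multiples of ∂ₙ, namely [∂ₙ, eₐ] = -(∂ₙΓⁿₐ) ∂ₙ and, on applying η, [eₐ, e_b] = -2ω_{ab} ∂ₙ.

In `koszul` for three horizontal fields the brackets drop out, leaving the formula for `Gamma`.
Tested against ∂ₙ, only -½ ∂ₙg_{ab} = -C_{ab} and -ω_{ab} = ω_{ba} survive. The other symbols need
no further Koszul computation: differentiating g(e_b, ∂ₙ) = 0 and g(∂ₙ, ∂ₙ) = 1 controls ∇∂ₙ, and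
vanishing torsion exchanges ∇_{∂ₙ} eₐ for ∇_{eₐ} ∂ₙ up to a multiple of ∂ₙ. -/

namespace SubRiem

/-! ### Coordinate fields of a chart: smoothness, independence, commutation. -/

section Chart

variable {m : ℕ} {M : Type*} [TopologicalSpace M]
  [ChartedSpace (EuclideanSpace ℝ (Fin (2 * m + 1))) M]
  {φ : OpenPartialHomeomorph M (EuclideanSpace ℝ (Fin (2 * m + 1)))}

theorem mdifferentiable_of_mem_maximalAtlas
    (hφ : φ ∈ IsManifold.maximalAtlas (𝓡 (2 * m + 1)) ∞ M) :
    φ.MDifferentiable (𝓡 (2 * m + 1)) 𝓘(ℝ, EuclideanSpace ℝ (Fin (2 * m + 1))) :=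
  ⟨fun _ hx ↦ ((contMDiffAt_of_mem_maximalAtlas hφ hx).mdifferentiableAt
      (by simp)).mdifferentiableWithinAt,
    fun _ hx ↦ ((contMDiffAt_symm_of_mem_maximalAtlas hφ hx).mdifferentiableAt
      (by simp)).mdifferentiableWithinAt⟩

theorem isInvertible_mfderiv_of_mem_maximalAtlas
    (hφ : φ ∈ IsManifold.maximalAtlas (𝓡 (2 * m + 1)) ∞ M) {x : M} (hx : x ∈ φ.source) :
    (mfderiv (𝓡 (2 * m + 1)) 𝓘(ℝ, EuclideanSpace ℝ (Fin (2 * m + 1))) φ x).IsInvertible :=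
  ⟨(mdifferentiable_of_mem_maximalAtlas hφ).mfderiv hx, rfl⟩

theorem dirDeriv_congr (X : VField m M) {f g : M → ℝ} {x : M} (h : f =ᶠ[nhds x] g) :
    dirDeriv X f x = dirDeriv X g x := by
  simp only [dirDeriv, mvfderiv, h.mfderiv_eq]
  rfl

theorem dirDeriv_eq_zero_of_eqOn {u : Set M} (hu : IsOpen u) (X : VField m M) {f : M → ℝ} {c : ℝ}
    (hf : ∀ y ∈ u, f y = c) {x : M} (hx : x ∈ u) : dirDeriv X f x = 0 := by
  rw [dirDeriv_congr X (g := fun _ ↦ c), dirDeriv, mvfderiv_const]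
  · rfl
  · filter_upwards [hu.mem_nhds hx] with y hy using hf y hy

theorem contMDiff_constField {n : ℕ} (v : EuclideanSpace ℝ (Fin n)) :
    ContMDiff (𝓡 n) (𝓡 n).tangent ∞
      (fun y ↦ (⟨y, v⟩ : TangentBundle (𝓡 n) (EuclideanSpace ℝ (Fin n)))) := fun _ ↦
  contMDiffAt_vectorSpace_iff_contDiffAt.2 contDiffAt_const

theorem mlieBracket_constField {n : ℕ} (v w y : EuclideanSpace ℝ (Fin n)) :
    mlieBracket (𝓡 n) (fun _ ↦ v) (fun _ ↦ w) y = 0 := by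
  have h := congrFun (mlieBracketWithin_eq_lieBracketWithin (𝕜 := ℝ) (s := Set.univ)
    (V := fun _ : EuclideanSpace ℝ (Fin n) ↦ v) (W := fun _ ↦ w)) y
  refine (congrFun mlieBracketWithin_univ y).symm.trans (h.trans ?_)
  simp [lieBracketWithin]
  rfl

/-- The coordinate fields of a chart form a basis of each tangent space over its domain. -/
theorem exists_basis_coordField
    (hφ : φ ∈ IsManifold.maximalAtlas (𝓡 (2 * m + 1)) ∞ M) {x : M} (hx : x ∈ φ.source) :
    ∃ b : Module.Basis (Fin (2 * m + 1)) ℝ (TangentSpace (𝓡 (2 * m + 1)) x),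
      ∀ i, b i = coordField φ i x := by
  obtain ⟨L, hL⟩ := isInvertible_mfderiv_of_mem_maximalAtlas hφ hx
  let b : Module.Basis (Fin (2 * m + 1)) ℝ (TangentSpace (𝓡 (2 * m + 1)) (φ x)) :=
    (EuclideanSpace.basisFun (Fin (2 * m + 1)) ℝ).toBasis
  refine ⟨b.map L.symm.toLinearEquiv, fun i ↦ ?_⟩
  have hb : b i = EuclideanSpace.single i (1 : ℝ) :=
    (congrFun (EuclideanSpace.basisFun _ ℝ).coe_toBasis i).trans (EuclideanSpace.basisFun_apply ..)
  have hc : coordField φ i x = L.symm (EuclideanSpace.single i (1 : ℝ)) := by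
    refine (mpullback_apply ..).trans ?_
    rw [← hL, ContinuousLinearMap.inverse_equiv]
    rfl
  rw [hc, ← hb]
  rfl

variable [IsManifold (𝓡 (2 * m + 1)) ∞ M]

theorem contMDiffAt_coordField
    (hφ : φ ∈ IsManifold.maximalAtlas (𝓡 (2 * m + 1)) ∞ M) {x : M} (hx : x ∈ φ.source)
    (i : Fin (2 * m + 1)) :
    ContMDiffAt (𝓡 (2 * m + 1)) (𝓡 (2 * m + 1)).tangent ∞
      (fun y ↦ (⟨y, coordField φ i y⟩ : TangentBundle (𝓡 (2 * m + 1)) M)) x :=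
  ContMDiffAt.mpullback_vectorField_preimage (n := ∞) (contMDiff_constField _ _)
    (contMDiffAt_of_mem_maximalAtlas hφ hx) (isInvertible_mfderiv_of_mem_maximalAtlas hφ hx)
    (by simp)

theorem mlieBracket_coordField
    (hφ : φ ∈ IsManifold.maximalAtlas (𝓡 (2 * m + 1)) ∞ M) {x : M} (hx : x ∈ φ.source)
    (i j : Fin (2 * m + 1)) :
    mlieBracket (𝓡 (2 * m + 1)) (coordField φ i) (coordField φ j) x = 0 := by
  -- Over ℝ, `minSmoothness ℝ 2` is just 2.
  have : IsManifold (𝓡 (2 * m + 1)) (minSmoothness ℝ 2) M := by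
    rw [minSmoothness_of_isRCLikeNormedField]; infer_instance
  have h := mpullback_mlieBracket (I := 𝓡 (2 * m + 1)) (n := ∞)
    (V := fun _ ↦ EuclideanSpace.single i (1 : ℝ)) (W := fun _ ↦ EuclideanSpace.single j (1 : ℝ))
    (I' := 𝓘(ℝ, EuclideanSpace ℝ (Fin (2 * m + 1)))) (f := φ) (x₀ := x)
    ((contMDiff_constField _).mdifferentiable (by simp) _)
    ((contMDiff_constField _).mdifferentiable (by simp) _)
    (contMDiffAt_of_mem_maximalAtlas hφ hx)
    (by rw [minSmoothness_of_isRCLikeNormedField]; exact ENat.LEInfty.out)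
  refine h.symm.trans ?_
  rw [mpullback_apply, mlieBracket_constField, map_zero]

end Chart

/-! ### The orthogonal splitting and the adapted frame. -/

section

variable {m : ℕ} {M : Type*} [TopologicalSpace M]
  [ChartedSpace (EuclideanSpace ℝ (Fin (2 * m + 1))) M] [IsManifold (𝓡 (2 * m + 1)) ∞ M]
  [RiemannianBundle (fun x : M ↦ TangentSpace (𝓡 (2 * m + 1)) x)]

namespace ContactTypeStructure

variable (S : ContactTypeStructure m M)

theorem sub_smul_ξ_mem_D (x : M) (v : TangentSpace (𝓡 (2 * m + 1)) x) :
    v - S.η x v • S.ξ x ∈ S.D x := by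
  simp [S.D_eq, S.η_ξ]

theorem ξ_mem_orthogonal_D (x : M) : S.ξ x ∈ (S.D x)ᗮ := by
  rw [S.orthogonal_D_eq]
  exact Submodule.mem_span_singleton_self _

/-- η is the metric dual of ξ: the D-part of `v` is orthogonal to ξ, and ξ is a unit vector. -/
theorem η_eq_inner (x : M) (v : TangentSpace (𝓡 (2 * m + 1)) x) :
    S.η x v = inner ℝ v (S.ξ x) := by
  have h := (Submodule.mem_orthogonal _ _).1 (S.ξ_mem_orthogonal_D x) _ (S.sub_smul_ξ_mem_D x v)
  rw [inner_sub_left, real_inner_smul_left, S.inner_ξ_ξ] at h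
  linarith

theorem P_apply (x : M) (v : TangentSpace (𝓡 (2 * m + 1)) x) :
    S.P x v = v - S.η x v • S.ξ x := by
  refine Submodule.eq_starProjection_of_mem_of_inner_eq_zero (S.sub_smul_ξ_mem_D x v) ?_
  intro w hw
  have h := (Submodule.mem_orthogonal _ _).1 (S.ξ_mem_orthogonal_D x) w hw
  rw [real_inner_comm] at h
  simp [inner_smul_left, h]

variable {S} {φ : OpenPartialHomeomorph M (EuclideanSpace ℝ (Fin (2 * m + 1)))}

theorem contMDiffAt_η {X : VField m M} {x : M}
    (hX : ContMDiffAt (𝓡 (2 * m + 1)) (𝓡 (2 * m + 1)).tangent ∞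
      (fun y ↦ (⟨y, X y⟩ : TangentBundle (𝓡 (2 * m + 1)) M)) x) :
    ContMDiffAt (𝓡 (2 * m + 1)) 𝓘(ℝ, ℝ) ∞ (fun y ↦ S.η y (X y)) x := by
  have h : ContMDiffAt (𝓡 (2 * m + 1)) ((𝓡 (2 * m + 1)).prod 𝓘(ℝ, ℝ)) ∞
      (fun y ↦ TotalSpace.mk' ℝ (E := Bundle.Trivial M ℝ) y (S.η y (X y))) x :=
    ContMDiffAt.clm_bundle_apply (F₁ := EuclideanSpace ℝ (Fin (2 * m + 1)))
      S.contMDiff_η.contMDiffAt hX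
  rw [contMDiffAt_totalSpace] at h
  exact h.2

@[simp] theorem frame_castSucc (a : Fin (2 * m)) : S.frame φ a.castSucc = S.e φ a := by
  simp [frame]

@[simp] theorem frame_last : S.frame φ (Fin.last (2 * m)) = coordField φ (Fin.last (2 * m)) := by
  simp [frame]

namespace IsAdaptedChart

variable (hφ : S.IsAdaptedChart φ)
include hφ

theorem e_apply {x : M} (hx : x ∈ φ.source) (a : Fin (2 * m)) :
    S.e φ a x = coordField φ a.castSucc x
      - S.GammaN φ a x • coordField φ (Fin.last (2 * m)) x := by
  rw [e, P_apply, hφ.coordField_last x hx, GammaN]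

/-- Brackets depend only on germs, and the Leibniz rules need a sum of sections and a function times
a section. -/
theorem e_eventuallyEq {x : M} (hx : x ∈ φ.source) (a : Fin (2 * m)) :
    S.e φ a =ᶠ[nhds x]
      coordField φ a.castSucc + (-S.GammaN φ a) • coordField φ (Fin.last (2 * m)) := by
  filter_upwards [φ.open_source.mem_nhds hx] with y hy
  rw [hφ.e_apply hy]
  exact (sub_eq_add_neg _ _).trans (congrArg _ (neg_smul _ _).symm)

theorem contMDiffAt_GammaN {x : M} (hx : x ∈ φ.source) (a : Fin (2 * m)) :
    ContMDiffAt (𝓡 (2 * m + 1)) 𝓘(ℝ, ℝ) ∞ (S.GammaN φ a) x :=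
  contMDiffAt_η (contMDiffAt_coordField hφ.mem_maximalAtlas hx _)

theorem contMDiffAt_e {x : M} (hx : x ∈ φ.source) (a : Fin (2 * m)) :
    ContMDiffAt (𝓡 (2 * m + 1)) (𝓡 (2 * m + 1)).tangent ∞
      (fun y ↦ (⟨y, S.e φ a y⟩ : TangentBundle (𝓡 (2 * m + 1)) M)) x := by
  have h := (contMDiffAt_coordField hφ.mem_maximalAtlas hx a.castSucc).add_section
    ((hφ.contMDiffAt_GammaN hx a).neg.smul_section
      (contMDiffAt_coordField hφ.mem_maximalAtlas hx (Fin.last (2 * m))))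
  refine h.congr_of_eventuallyEq ?_
  filter_upwards [hφ.e_eventuallyEq hx a] with y hy
  rw [hy]
  rfl

/-- The passage from coordinate fields to the frame is unitriangular: ∂ₐ = eₐ + Γⁿₐ ∂ₙ, so the frame
spans, and having as many members as the dimension it is independent. -/
theorem isLocalFrameOn :
    IsLocalFrameOn (𝓡 (2 * m + 1)) (EuclideanSpace ℝ (Fin (2 * m + 1))) ∞
      (S.frame φ) φ.source := by
  have hspan {x : M} (hx : x ∈ φ.source) :
      ⊤ ≤ Submodule.span ℝ (Set.range (S.frame φ · x)) := by
    obtain ⟨b, hb⟩ := exists_basis_coordField hφ.mem_maximalAtlas hx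
    rw [← b.span_eq, Submodule.span_le]
    rintro _ ⟨i, rfl⟩
    have hn : coordField φ (Fin.last (2 * m)) x ∈
        Submodule.span ℝ (Set.range (S.frame φ · x)) :=
      Submodule.subset_span ⟨Fin.last (2 * m), by simp⟩
    rw [hb]
    refine Fin.lastCases hn (fun a ↦ ?_) i
    have ha : S.e φ a x ∈ Submodule.span ℝ (Set.range (S.frame φ · x)) :=
      Submodule.subset_span ⟨a.castSucc, by simp⟩
    have := add_mem ha (Submodule.smul_mem _ (S.GammaN φ a x) hn)
    rwa [hφ.e_apply hx, sub_add_cancel] at this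
  refine ⟨fun {x} hx ↦ ?_, hspan, fun i ↦ ?_⟩
  · obtain ⟨b, -⟩ := exists_basis_coordField hφ.mem_maximalAtlas hx
    exact linearIndependent_of_top_le_span_of_card_eq_finrank (hspan hx)
      (Module.finrank_eq_card_basis b).symm
  · refine Fin.lastCases ?_ (fun a ↦ ?_) i
    · rw [frame_last]
      exact fun x hx ↦ (contMDiffAt_coordField hφ.mem_maximalAtlas hx _).contMDiffWithinAt
    · rw [frame_castSucc]
      exact fun x hx ↦ (hφ.contMDiffAt_e hx a).contMDiffWithinAt

theorem inner_e_last {x : M} (hx : x ∈ φ.source) (a : Fin (2 * m)) :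
    inner ℝ (S.e φ a x) (coordField φ (Fin.last (2 * m)) x) = 0 := by
  rw [hφ.coordField_last x hx, ← η_eq_inner, e, P_apply]
  simp [S.η_ξ]

theorem inner_last_last {x : M} (hx : x ∈ φ.source) :
    inner ℝ (coordField φ (Fin.last (2 * m)) x) (coordField φ (Fin.last (2 * m)) x) = 1 := by
  rw [hφ.coordField_last x hx, S.inner_ξ_ξ]

theorem coeff_last
    (h : IsLocalFrameOn (𝓡 (2 * m + 1)) (EuclideanSpace ℝ (Fin (2 * m + 1))) ∞
      (S.frame φ) φ.source)
    {x : M} (hx : x ∈ φ.source) (v : TangentSpace (𝓡 (2 * m + 1)) x) :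
    h.coeff (Fin.last (2 * m)) x v = inner ℝ v (coordField φ (Fin.last (2 * m)) x) := by
  have hv := (h.toBasisAt hx).sum_repr v
  rw [Fin.sum_univ_castSucc] at hv
  conv_rhs => rw [← hv]
  simp [IsLocalFrameOn.coeff, hx, inner_add_left, sum_inner, inner_smul_left,
    hφ.inner_e_last hx, -inner_self_eq_norm_sq_to_K,
    hφ.inner_last_last hx]

/-- The linear system for the horizontal components, solved in `coeff_castSucc`. -/
theorem inner_e_eq_sum_coeff
    (h : IsLocalFrameOn (𝓡 (2 * m + 1)) (EuclideanSpace ℝ (Fin (2 * m + 1))) ∞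
      (S.frame φ) φ.source)
    {x : M} (hx : x ∈ φ.source) (v : TangentSpace (𝓡 (2 * m + 1)) x) (c : Fin (2 * m)) :
    inner ℝ v (S.e φ c x) = ∑ a : Fin (2 * m), h.coeff a.castSucc x v * S.gLow φ x a c := by
  have hv := (h.toBasisAt hx).sum_repr v
  rw [Fin.sum_univ_castSucc] at hv
  have h0 := hφ.inner_e_last hx c
  rw [real_inner_comm] at h0
  conv_lhs => rw [← hv]
  simp [IsLocalFrameOn.coeff, hx, inner_add_left, sum_inner, inner_smul_left, h0, gLow]

/-- A Gram matrix of independent vectors is positive definite. -/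
theorem isUnit_det_gLow {x : M} (hx : x ∈ φ.source) : IsUnit (S.gLow φ x).det := by
  have hli : LinearIndependent ℝ (fun a : Fin (2 * m) ↦ S.e φ a x) := by
    have := (hφ.isLocalFrameOn.linearIndependent hx).comp _ (Fin.castSucc_injective (2 * m))
    simpa [Function.comp_def] using this
  exact (Matrix.posDef_gram_of_linearIndependent hli).det_pos.ne'.isUnit

theorem coeff_castSucc
    (h : IsLocalFrameOn (𝓡 (2 * m + 1)) (EuclideanSpace ℝ (Fin (2 * m + 1))) ∞
      (S.frame φ) φ.source)
    {x : M} (hx : x ∈ φ.source) (v : TangentSpace (𝓡 (2 * m + 1)) x) (b : Fin (2 * m)) :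
    h.coeff b.castSucc x v = ∑ c, S.gUp φ x b c * inner ℝ v (S.e φ c x) := by
  have hsymm (c a : Fin (2 * m)) : S.gLow φ x a c = S.gLow φ x c a := by
    simp [gLow, real_inner_comm]
  have hmul : S.gUp φ x * S.gLow φ x = 1 := Matrix.nonsing_inv_mul _ (hφ.isUnit_det_gLow hx)
  have hv : (fun c ↦ inner ℝ v (S.e φ c x))
      = (S.gLow φ x).mulVec (fun a ↦ h.coeff a.castSucc x v) := by
    ext c
    simp_rw [hφ.inner_e_eq_sum_coeff h hx, Matrix.mulVec, dotProduct, hsymm c, mul_comm]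
  change _ = (S.gUp φ x).mulVec (fun c ↦ inner ℝ v (S.e φ c x)) b
  rw [hv, Matrix.mulVec_mulVec, hmul, Matrix.one_mulVec]

/-! ### Lie brackets of the adapted frame. -/

/-- The bracket of `∂ₙ` with the fields of the adapted frame. -/
theorem mlieBracket_last_e {x : M} (hx : x ∈ φ.source) (a : Fin (2 * m)) :
    mlieBracket (𝓡 (2 * m + 1)) (coordField φ (Fin.last (2 * m))) (S.e φ a) x
      = -(dirDeriv (coordField φ (Fin.last (2 * m))) (S.GammaN φ a) x) •
        coordField φ (Fin.last (2 * m)) x := by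
  have hd (i) := (contMDiffAt_coordField hφ.mem_maximalAtlas hx i).mdifferentiableAt
    (by simp : (∞ : WithTop ℕ∞) ≠ 0)
  have hG := (hφ.contMDiffAt_GammaN hx a).mdifferentiableAt (by simp)
  rw [Filter.EventuallyEq.rfl.mlieBracket_vectorField_eq (hφ.e_eventuallyEq hx a),
    mlieBracket_add_right (hd _) (hG.neg.smul_section (hd _)),
    mlieBracket_smul_right hG.neg (hd _), mlieBracket_coordField hφ.mem_maximalAtlas hx,
    mlieBracket_coordField hφ.mem_maximalAtlas hx, mvfderiv_neg]
  simp [dirDeriv]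

/-- Verticality alone is enough: η(∂ₙ) = 1, so applying η identifies the factor later, in
`mlieBracket_e_e`. -/
theorem exists_mlieBracket_e_e_eq_smul {x : M} (hx : x ∈ φ.source) (a b : Fin (2 * m)) :
    ∃ r : ℝ, mlieBracket (𝓡 (2 * m + 1)) (S.e φ a) (S.e φ b) x
      = r • coordField φ (Fin.last (2 * m)) x := by
  have hd (i) := (contMDiffAt_coordField hφ.mem_maximalAtlas hx i).mdifferentiableAt
    (by simp : (∞ : WithTop ℕ∞) ≠ 0)
  have hG (a) := (hφ.contMDiffAt_GammaN hx a).mdifferentiableAt (by simp)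
  have he := (hφ.e_eventuallyEq hx a).mlieBracket_vectorField_eq (I := 𝓡 (2 * m + 1))
    (hφ.e_eventuallyEq hx b)
  -- Used backwards, this folds the expanded e_b into `S.e φ b` again, so that the known bracket
  -- [∂ₙ, e_b] applies.
  have hn := Filter.EventuallyEq.rfl.mlieBracket_vectorField_eq (I := 𝓡 (2 * m + 1))
    (V := coordField φ (Fin.last (2 * m))) (hφ.e_eventuallyEq hx b)
  rw [he, mlieBracket_add_left (hd _) ((hG a).neg.smul_section (hd _)),
    mlieBracket_smul_left (hG a).neg (hd _), ← hn, hφ.mlieBracket_last_e hx,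
    mlieBracket_add_right (hd _) ((hG b).neg.smul_section (hd _)),
    mlieBracket_smul_right (hG b).neg (hd _), mlieBracket_coordField hφ.mem_maximalAtlas hx,
    mlieBracket_coordField hφ.mem_maximalAtlas hx, smul_zero, zero_add, add_zero, smul_smul,
    ← add_smul, ← add_smul]
  exact ⟨_, rfl⟩

end IsAdaptedChart

end ContactTypeStructure

end

/-! ### Components of ω, ψ and C in the adapted frame. -/

section

variable {m : ℕ} {M : Type*} [TopologicalSpace M]
  [ChartedSpace (EuclideanSpace ℝ (Fin (2 * m + 1))) M] [IsManifold (𝓡 (2 * m + 1)) ∞ M]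
  [RiemannianBundle (fun x : M ↦ TangentSpace (𝓡 (2 * m + 1)) x)]
  {S : ContactTypeStructure m M}
  {φ : OpenPartialHomeomorph M (EuclideanSpace ℝ (Fin (2 * m + 1)))}

namespace ContactTypeStructure.IsAdaptedChart

theorem diffAt_e (hφ : S.IsAdaptedChart φ) {x : M} (hx : x ∈ φ.source) (a : Fin (2 * m)) :
    DiffAt (S.e φ a) x :=
  (hφ.contMDiffAt_e hx a).mdifferentiableAt (by simp)

theorem diffAt_last (hφ : S.IsAdaptedChart φ) {x : M} (hx : x ∈ φ.source) :
    DiffAt (coordField φ (Fin.last (2 * m))) x :=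
  (contMDiffAt_coordField hφ.mem_maximalAtlas hx _).mdifferentiableAt (by simp)

/-- `[eₐ, e_b] = -2 ω_{ab} ∂ₙ`. -/
theorem mlieBracket_e_e (hφ : S.IsAdaptedChart φ) {x : M} (hx : x ∈ φ.source)
    (a b : Fin (2 * m)) :
    mlieBracket (𝓡 (2 * m + 1)) (S.e φ a) (S.e φ b) x
      = (-2 * S.omegaLow φ a b x) • coordField φ (Fin.last (2 * m)) x := by
  obtain ⟨r, hr⟩ := hφ.exists_mlieBracket_e_e_eq_smul hx a b
  have h0 (c : Fin (2 * m)) : ∀ y ∈ φ.source, S.η y (S.e φ c y) = 0 := fun y hy ↦ by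
    rw [S.η_eq_inner, ← hφ.coordField_last y hy, hφ.inner_e_last hy]
  -- Since η(e_c) = 0 on an open set, only the bracket term of dη remains; the ½ in its
  -- normalization produces the factor -2.
  have hω : S.omegaLow φ a b x = -(1 / 2) * r := by
    rw [omegaLow, S.omega_apply (hφ.diffAt_e hx a) (hφ.diffAt_e hx b), hr,
      dirDeriv_eq_zero_of_eqOn φ.open_source _ (h0 a) hx,
      dirDeriv_eq_zero_of_eqOn φ.open_source _ (h0 b) hx,
      hφ.coordField_last x hx, map_smul, S.η_ξ, smul_eq_mul]
    ring
  rw [hr, hω]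
  congr 1
  ring

theorem omegaLow_swap (hφ : S.IsAdaptedChart φ) {x : M} (hx : x ∈ φ.source)
    (a b : Fin (2 * m)) : S.omegaLow φ b a x = -S.omegaLow φ a b x := by
  rw [omegaLow, omegaLow, S.omega_apply (hφ.diffAt_e hx b) (hφ.diffAt_e hx a),
    S.omega_apply (hφ.diffAt_e hx a) (hφ.diffAt_e hx b), mlieBracket_swap_apply, map_neg]
  ring

theorem coeff_psi (hφ : S.IsAdaptedChart φ)
    (h : IsLocalFrameOn (𝓡 (2 * m + 1)) (EuclideanSpace ℝ (Fin (2 * m + 1))) ∞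
      (S.frame φ) φ.source)
    {x : M} (hx : x ∈ φ.source) (a b : Fin (2 * m)) :
    h.coeff b.castSucc x (S.psi x (S.e φ a x)) = ∑ c, S.gUp φ x b c * S.omegaLow φ a c x := by
  simp [hφ.coeff_castSucc h hx, ← S.omega_eq_inner_psi, omegaLow]

variable [IsContMDiffRiemannianBundle (𝓡 (2 * m + 1)) ∞ (EuclideanSpace ℝ (Fin (2 * m + 1)))
  (fun x : M ↦ TangentSpace (𝓡 (2 * m + 1)) x)]

/-- The brackets [ξ, eₐ] are vertical, hence orthogonal to the frame's horizontal fields, so only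
the derivative of g_{ab} is left in L_ξ g. -/
theorem CLow_eq (hφ : S.IsAdaptedChart φ) {x : M} (hx : x ∈ φ.source) (a b : Fin (2 * m)) :
    S.CLow φ a b x = (1 / 2) *
      dirDeriv (coordField φ (Fin.last (2 * m))) (fun y ↦ S.gLow φ y a b) x := by
  have hξ : S.ξ =ᶠ[nhds x] coordField φ (Fin.last (2 * m)) := by
    filter_upwards [φ.open_source.mem_nhds hx] with y hy using (hφ.coordField_last y hy).symm
  have hbr (c : Fin (2 * m)) := (hξ.mlieBracket_vectorField_eq (I := 𝓡 (2 * m + 1))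
    (Filter.EventuallyEq.refl _ (S.e φ c))).trans (hφ.mlieBracket_last_e hx c)
  have h0 := hφ.inner_e_last hx b
  rw [real_inner_comm] at h0
  rw [CLow, S.C_apply (hφ.diffAt_e hx a) (hφ.diffAt_e hx b), hbr, hbr, real_inner_smul_left,
    real_inner_smul_right, h0, hφ.inner_e_last hx, mul_zero, mul_zero, sub_zero, sub_zero,
    dirDeriv, dirDeriv, hφ.coordField_last x hx]
  rfl

end ContactTypeStructure.IsAdaptedChart

/-! ### The Levi-Civita connection on the adapted frame. -/

namespace IsLeviCivita

variable [IsContMDiffRiemannianBundle (𝓡 (2 * m + 1)) ∞ (EuclideanSpace ℝ (Fin (2 * m + 1)))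
    (fun x : M ↦ TangentSpace (𝓡 (2 * m + 1)) x)]
  {cov : CovariantDerivative (𝓡 (2 * m + 1)) (EuclideanSpace ℝ (Fin (2 * m + 1)))
    (TangentSpace (𝓡 (2 * m + 1)) : M → Type _)}

theorem dirDeriv_inner (hcov : IsLeviCivita cov) (X : VField m M) {Y Z : VField m M} {x : M}
    (hY : DiffAt Y x) (hZ : DiffAt Z x) :
    dirDeriv X (fun y ↦ inner ℝ (Y y) (Z y)) x
      = inner ℝ (cov Y x (X x)) (Z x) + inner ℝ (cov Z x (X x)) (Y x) := by
  have h := hcov.metric.mvfderiv_inner_eq X hY hZ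
  rw [dirDeriv, h, real_inner_comm (Y x)]

theorem cov_eq_add (hcov : IsLeviCivita cov) {X Y : VField m M} {x : M}
    (hX : DiffAt X x) (hY : DiffAt Y x) :
    cov Y x (X x) = cov X x (Y x) + mlieBracket (𝓡 (2 * m + 1)) X Y x := by
  rw [← (cov.torsion_eq_zero_iff.1 hcov.torsion_eq_zero) hX hY]
  abel

/-- Metric compatibility for the three derivatives, with torsion-freeness for the three pairs, is a
linear system in the inner products. -/
theorem koszul (hcov : IsLeviCivita cov) {X Y Z : VField m M} {x : M}
    (hX : DiffAt X x) (hY : DiffAt Y x) (hZ : DiffAt Z x) :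
    inner ℝ (cov Y x (X x)) (Z x) = (1 / 2) *
      (dirDeriv X (fun y ↦ inner ℝ (Y y) (Z y)) x + dirDeriv Y (fun y ↦ inner ℝ (X y) (Z y)) x
        - dirDeriv Z (fun y ↦ inner ℝ (X y) (Y y)) x
        + inner ℝ (mlieBracket (𝓡 (2 * m + 1)) X Y x) (Z x)
        - inner ℝ (mlieBracket (𝓡 (2 * m + 1)) X Z x) (Y x)
        - inner ℝ (mlieBracket (𝓡 (2 * m + 1)) Y Z x) (X x)) := by
  have hXY := congrArg (inner ℝ · (Z x)) (hcov.cov_eq_add hX hY)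
  have hXZ := congrArg (inner ℝ · (Y x)) (hcov.cov_eq_add hX hZ)
  have hYZ := congrArg (inner ℝ · (X x)) (hcov.cov_eq_add hY hZ)
  simp only [inner_add_left] at hXY hXZ hYZ
  rw [hcov.dirDeriv_inner X hY hZ, hcov.dirDeriv_inner Y hX hZ, hcov.dirDeriv_inner Z hX hY]
  linarith

variable (hcov : IsLeviCivita cov) (hφ : S.IsAdaptedChart φ) {x : M} (hx : x ∈ φ.source)
include hcov hφ hx

theorem inner_cov_e_e_e (a b c : Fin (2 * m)) :
    inner ℝ (cov (S.e φ b) x (S.e φ a x)) (S.e φ c x) = (1 / 2) *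
      (dirDeriv (S.e φ a) (fun y ↦ S.gLow φ y b c) x
        + dirDeriv (S.e φ b) (fun y ↦ S.gLow φ y a c) x
        - dirDeriv (S.e φ c) (fun y ↦ S.gLow φ y a b) x) := by
  have h0 (d : Fin (2 * m)) := hφ.inner_e_last hx d
  simp_rw [real_inner_comm] at h0
  rw [hcov.koszul (hφ.diffAt_e hx a) (hφ.diffAt_e hx b) (hφ.diffAt_e hx c)]
  simp only [hφ.mlieBracket_e_e hx, real_inner_smul_left, h0, mul_zero, add_zero, sub_zero]
  rfl

theorem inner_cov_e_e_last (a b : Fin (2 * m)) :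
    inner ℝ (cov (S.e φ b) x (S.e φ a x)) (coordField φ (Fin.last (2 * m)) x)
      = S.omegaLow φ b a x - S.CLow φ a b x := by
  have h0 (d : Fin (2 * m)) := hφ.inner_e_last hx d
  simp_rw [real_inner_comm] at h0
  have hsym (d : Fin (2 * m)) : mlieBracket (𝓡 (2 * m + 1)) (S.e φ d)
      (coordField φ (Fin.last (2 * m))) x = _ :=
    mlieBracket_swap_apply.trans (congrArg _ (hφ.mlieBracket_last_e hx d))
  rw [hcov.koszul (hφ.diffAt_e hx a) (hφ.diffAt_e hx b) (hφ.diffAt_last hx), hφ.CLow_eq hx,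
    hφ.omegaLow_swap hx a b, hsym, hsym, hφ.mlieBracket_e_e hx,
    dirDeriv_eq_zero_of_eqOn φ.open_source _
      (fun y hy ↦ hφ.inner_e_last hy b) hx,
    dirDeriv_eq_zero_of_eqOn φ.open_source _
      (fun y hy ↦ hφ.inner_e_last hy a) hx]
  simp only [inner_neg_left, real_inner_smul_left, h0, hφ.inner_last_last hx]
  change (1 / 2) * (_ - dirDeriv _ (fun y ↦ S.gLow φ y a b) x + _ - _ - _) = _
  ring

/-- Differentiate g(e_b, ∂ₙ) = 0 along `X`. -/
theorem inner_cov_last_e (X : VField m M) (b : Fin (2 * m)) :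
    inner ℝ (cov (coordField φ (Fin.last (2 * m))) x (X x)) (S.e φ b x)
      = -inner ℝ (cov (S.e φ b) x (X x)) (coordField φ (Fin.last (2 * m)) x) := by
  have h := hcov.dirDeriv_inner X (hφ.diffAt_e hx b) (hφ.diffAt_last hx)
  rw [dirDeriv_eq_zero_of_eqOn φ.open_source _
    (fun y hy ↦ hφ.inner_e_last hy b) hx] at h
  linarith

/-- Differentiate g(∂ₙ, ∂ₙ) = 1 along `X`. -/
theorem inner_cov_last_last (X : VField m M) :
    inner ℝ (cov (coordField φ (Fin.last (2 * m))) x (X x))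
      (coordField φ (Fin.last (2 * m)) x) = 0 := by
  have h := hcov.dirDeriv_inner X (hφ.diffAt_last hx) (hφ.diffAt_last hx)
  rw [dirDeriv_eq_zero_of_eqOn φ.open_source _
    (fun y hy ↦ hφ.inner_last_last hy) hx] at h
  linarith

/-- `∇_{∂ₙ} eₐ = ∇_{eₐ} ∂ₙ - (∂ₙ Γⁿₐ) ∂ₙ`. -/
theorem cov_e_last (a : Fin (2 * m)) :
    cov (S.e φ a) x (coordField φ (Fin.last (2 * m)) x)
      = cov (coordField φ (Fin.last (2 * m))) x (S.e φ a x)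
        + -(dirDeriv (coordField φ (Fin.last (2 * m))) (S.GammaN φ a) x) •
          coordField φ (Fin.last (2 * m)) x := by
  rw [hcov.cov_eq_add (hφ.diffAt_last hx) (hφ.diffAt_e hx a), hφ.mlieBracket_last_e hx]

theorem inner_cov_e_last_last (a : Fin (2 * m)) :
    inner ℝ (cov (S.e φ a) x (coordField φ (Fin.last (2 * m)) x))
        (coordField φ (Fin.last (2 * m)) x)
      = -dirDeriv (coordField φ (Fin.last (2 * m))) (S.GammaN φ a) x := by
  rw [hcov.cov_e_last hφ hx, inner_add_left, real_inner_smul_left, hφ.inner_last_last hx,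
    hcov.inner_cov_last_last hφ hx (S.e φ a)]
  ring

/-- Before raising the index this reads g(∇_{eₐ} ∂ₙ, e_c) = -(ω_{ca} - C_{ac}) = C_{ac} + ω_{ac}. -/
theorem coeff_cov_last_e
    (h : IsLocalFrameOn (𝓡 (2 * m + 1)) (EuclideanSpace ℝ (Fin (2 * m + 1))) ∞
      (S.frame φ) φ.source) (a b : Fin (2 * m)) :
    h.coeff b.castSucc x (cov (coordField φ (Fin.last (2 * m))) x (S.e φ a x))
      = S.CMixed φ b a x + h.coeff b.castSucc x (S.psi x (S.e φ a x)) := by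
  rw [hφ.coeff_psi h hx, ContactTypeStructure.CMixed, hφ.coeff_castSucc h hx,
    ← Finset.sum_add_distrib]
  refine Finset.sum_congr rfl fun c _ ↦ ?_
  rw [hcov.inner_cov_last_e hφ hx (S.e φ a), hcov.inner_cov_e_e_last hφ hx,
    hφ.omegaLow_swap hx a c]
  ring

end IsLeviCivita

end

end SubRiem

/-! ### Assembly of the Christoffel symbols. -/

theorem proposition1 {m : ℕ} {M : Type*} [TopologicalSpace M]
    [ChartedSpace (EuclideanSpace ℝ (Fin (2 * m + 1))) M] [IsManifold (𝓡 (2 * m + 1)) ∞ M]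
    [RiemannianBundle (fun x : M ↦ TangentSpace (𝓡 (2 * m + 1)) x)]
    [IsContMDiffRiemannianBundle (𝓡 (2 * m + 1)) ∞ (EuclideanSpace ℝ (Fin (2 * m + 1)))
      (fun x : M ↦ TangentSpace (𝓡 (2 * m + 1)) x)]
    (S : SubRiem.ContactTypeStructure m M)
    (φ : OpenPartialHomeomorph M (EuclideanSpace ℝ (Fin (2 * m + 1))))
    (hφ : S.IsAdaptedChart φ)
    (cov : CovariantDerivative (𝓡 (2 * m + 1)) (EuclideanSpace ℝ (Fin (2 * m + 1)))
      (TangentSpace (𝓡 (2 * m + 1)) : M → Type _))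
    (hcov : SubRiem.IsLeviCivita cov) :
    ∃ h : IsLocalFrameOn (𝓡 (2 * m + 1)) (EuclideanSpace ℝ (Fin (2 * m + 1))) ∞
        (S.frame φ) φ.source,
      ∀ x ∈ φ.source,
        (∀ a : Fin (2 * m), S.e φ a x = SubRiem.coordField φ a.castSucc x
          - S.GammaN φ a x • SubRiem.coordField φ (Fin.last (2 * m)) x) ∧
        (∀ a b c : Fin (2 * m), S.christoffel h cov c.castSucc a.castSucc b.castSucc x = S.Gamma φ c a b x) ∧
        (∀ a b : Fin (2 * m), S.christoffel h cov (Fin.last (2 * m)) a.castSucc b.castSucc x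
          = S.omegaLow φ b a x - S.CLow φ a b x) ∧
        (∀ a b : Fin (2 * m), S.christoffel h cov b.castSucc a.castSucc (Fin.last (2 * m)) x
          = S.CMixed φ b a x + h.coeff b.castSucc x (S.psi x (S.e φ a x))) ∧
        (∀ a b : Fin (2 * m), S.christoffel h cov b.castSucc (Fin.last (2 * m)) a.castSucc x
          = S.CMixed φ b a x + h.coeff b.castSucc x (S.psi x (S.e φ a x))) ∧
        (∀ a : Fin (2 * m), S.christoffel h cov (Fin.last (2 * m)) (Fin.last (2 * m)) a.castSucc x
          = -SubRiem.dirDeriv (SubRiem.coordField φ (Fin.last (2 * m))) (S.GammaN φ a) x) ∧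
        (∀ a : Fin (2 * m), S.christoffel h cov a.castSucc (Fin.last (2 * m)) (Fin.last (2 * m)) x
          = ∑ b, S.gUp φ x a b *
              SubRiem.dirDeriv (SubRiem.coordField φ (Fin.last (2 * m))) (S.GammaN φ b) x) ∧
        (∀ a : Fin (2 * m), S.christoffel h cov (Fin.last (2 * m)) a.castSucc (Fin.last (2 * m)) x = 0) ∧
        S.christoffel h cov (Fin.last (2 * m)) (Fin.last (2 * m)) (Fin.last (2 * m)) x = 0 ∧
        (∀ a b : Fin (2 * m), h.coeff b.castSucc x (S.psi x (S.e φ a x))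
          = ∑ c, S.gUp φ x b c * S.omegaLow φ a c x) ∧
        (∀ a b : Fin (2 * m), S.CLow φ a b x = (1 / 2) *
          SubRiem.dirDeriv (SubRiem.coordField φ (Fin.last (2 * m)))
            (fun y ↦ S.gLow φ y a b) x) := by
  refine ⟨hφ.isLocalFrameOn, fun x hx ↦ ⟨fun a ↦ hφ.e_apply hx a, fun a b c ↦ ?_, fun a b ↦ ?_,
    fun a b ↦ ?_, fun a b ↦ ?_, fun a ↦ ?_, fun a ↦ ?_, fun a ↦ ?_, ?_,
    fun a b ↦ hφ.coeff_psi _ hx a b, fun a b ↦ hφ.CLow_eq hx a b⟩⟩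
  all_goals
    simp only [SubRiem.ContactTypeStructure.christoffel,
      SubRiem.ContactTypeStructure.frame_castSucc, SubRiem.ContactTypeStructure.frame_last]
  · simp only [hφ.coeff_castSucc _ hx, hcov.inner_cov_e_e_e hφ hx,
      SubRiem.ContactTypeStructure.Gamma, Finset.mul_sum]
    exact Finset.sum_congr rfl fun d _ ↦ by ring
  · rw [hφ.coeff_last _ hx, hcov.inner_cov_e_e_last hφ hx]
  · exact hcov.coeff_cov_last_e hφ hx _ a b
  -- ∇_{∂ₙ} eₐ and ∇_{eₐ} ∂ₙ differ by a multiple of ∂ₙ, which the horizontal components do not see.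
  · have h0 := fun c ↦ hφ.inner_e_last hx c
    simp_rw [real_inner_comm] at h0
    rw [← hcov.coeff_cov_last_e hφ hx, hφ.coeff_castSucc _ hx, hφ.coeff_castSucc _ hx,
      hcov.cov_e_last hφ hx]
    simp only [inner_add_left, real_inner_smul_left, h0, mul_zero, add_zero]
  · rw [hφ.coeff_last _ hx, hcov.inner_cov_e_last_last hφ hx]
  · simp only [hφ.coeff_castSucc _ hx, hcov.inner_cov_last_e hφ hx,
      hcov.inner_cov_e_last_last hφ hx, neg_neg]
  · rw [hφ.coeff_last _ hx, hcov.inner_cov_last_last hφ hx (S.e φ a)]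
  · rw [hφ.coeff_last _ hx, hcov.inner_cov_last_last hφ hx]
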